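/- Let $D\ge 1$ and let $\mathcal E=\{p_\alpha,\rho_\alpha\}_{\alpha=0,1}$ be any two-state ensemble on the Hilbert space $\mathbb C^D$: $p_0,p_1\ge 0$, $p_0+p_1=1$, and $\rho_0,\rho_1$ are density matrices (positive semidefinite, of trace $1$). Let $H$ be any Hamiltonian, that is, a Hermitian $D\times D$ matrix, with operator norm $\|H\|$. For $t\in\mathbb R$ put $$\rho(t)=p_0\,\rho_0+p_1\,e^{iHt}\rho_1e^{-iHt},\qquad S(\rho)=-\operatorname{Tr}(\rho\log_2\rho)\quad(0\log_2 0=0).$$ Then $t\mapsto S(\rho(t))$ is differentiable at $t=0$, and the mixing rate $\Lambda(\mathcal E,H)=\left.\frac{d}{dt}S(\rho(t))\right|_{t=0}$ satisfies $$\Lambda(\mathcal E,H)\le 2\,\|H\|.$$ The constant $2$ does not depend on the dimension $D$ (nor on $\mathcal E$ or $H$). -/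

import Mathlib

open scoped ComplexOrder

noncomputable section

/-- A density matrix (mixed state) on the Hilbert space `ℂⁿ`. -/
structure IsDensityMatrix {n : Type*} [Fintype n] (ρ : Matrix n n ℂ) : Prop where
  posSemidef : ρ.PosSemidef
  trace_eq_one : ρ.trace = 1

/-- A two-state ensemble `{p_α, ρ_α}` with `α = 0, 1`, on the Hilbert space `ℂⁿ`. -/
structure TwoStateEnsemble (n : Type*) [Fintype n] where
  p : Fin 2 → ℝ
  state : Fin 2 → Matrix n n ℂ
  p_nonneg : ∀ α, 0 ≤ p α
  p_sum : p 0 + p 1 = 1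
  state_density : ∀ α, IsDensityMatrix (state α)

/-- The von Neumann entropy `S(ρ) = - Tr (ρ log ρ)`, logarithm to base two. The logarithm is the
functional calculus of the Hermitian matrix `ρ`; since `Real.logb 2 0 = 0`, a zero eigenvalue
contributes `0 log 0 = 0`. -/
def vonNeumannEntropy {n : Type*} [Fintype n] [DecidableEq n] (ρ : Matrix n n ℂ) : ℝ :=
  -(ρ * cfc (Real.logb 2) ρ).trace.re

/-- The unitary evolution `U(t) = exp (i H t)`. -/
def evolution {n : Type*} [Fintype n] [DecidableEq n] (H : Matrix n n ℂ) (t : ℝ) :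
    Matrix n n ℂ :=
  NormedSpace.exp ((Complex.I * (t : ℂ)) • H)

/-- `ρ(t) = p₀ ρ₀ + p₁ exp (i H t) ρ₁ exp (-i H t)`. -/
def TwoStateEnsemble.evolved {n : Type*} [Fintype n] [DecidableEq n]
    (E : TwoStateEnsemble n) (H : Matrix n n ℂ) (t : ℝ) : Matrix n n ℂ :=
  (E.p 0 : ℂ) • E.state 0 +
    (E.p 1 : ℂ) • (evolution H t * E.state 1 * evolution H (-t))

/-- The entropy `S(ρ(t))` as a function of time. -/
def TwoStateEnsemble.entropyAt {n : Type*} [Fintype n] [DecidableEq n]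
    (E : TwoStateEnsemble n) (H : Matrix n n ℂ) (t : ℝ) : ℝ :=
  vonNeumannEntropy (E.evolved H t)

/-- The mixing rate `Λ(E, H)`, the derivative of `S(ρ(t))` at `t = 0`. -/
def mixingRate {n : Type*} [Fintype n] [DecidableEq n]
    (E : TwoStateEnsemble n) (H : Matrix n n ℂ) : ℝ :=
  deriv (E.entropyAt H) 0

/-- The operator norm of a matrix acting on `ℂⁿ` with its Euclidean (Hilbert space) norm. -/
def operatorNorm {n : Type*} [Fintype n] [DecidableEq n] (H : Matrix n n ℂ) : ℝ :=
  ‖Matrix.toEuclideanCLM (n := n) (𝕜 := ℂ) H‖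

end

/-!
Write `A = p₁ ρ₁`, `B = p₀ ρ₀` and `ρ = A + B`, and let `U(t) = exp (i H t)`. All logarithms in the
argument are natural; base two only brings in the factor `1 / log 2 ≤ 2` at the end.

*Differentiability.* The entropy need not be differentiable at singular states, and the rank of
`B + U(t) A U(-t)` may jump at `t = 0`. In an eigenbasis of `ρ`, with eigenvalues `l i`, the diagonal
entries of `-M log M` at `M = B + U(t) A U(-t)` are squeezed between functions differentiable at `0`
with a common derivative (`hasDerivAt_trace_cfc_negMulLog`): scalar quadratic bounds on `-y log y`
carry over to matrices by `cfc_apply_self_re_le`, and at the zero eigenvalues of `ρ` the diagonal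
entry of `M` is `O(t ^ 2)`, because `A` annihilates the corresponding eigenvector. The derivative is
`-Tr (i [H, A] log ρ) = -i Tr (H [A, log ρ])`.

*The bound.* Let `X` be the derivative of the logarithm at `ρ` in the direction `A`; in the eigenbasis
it is the entrywise product of `A` with the divided differences of the logarithm. Then
`[log ρ, A] = [ρ, X]`. The matrix of divided differences is positive semidefinite
(`posSemidef_logSlope`), so by the Schur product theorem `X` is positive semidefinite, and so is the
analogous matrix for `B`. The two add up to the derivative in the direction `ρ`, which is the support
projection of `ρ`; hence `0 ≤ X ≤ 1`. Replacing `X` by `X - 1/2`, of norm at most `1/2`, does not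
change the commutator, so `|Tr (H [ρ, X])| ≤ 2 ‖H‖ ‖X - 1/2‖ Tr ρ ≤ ‖H‖`
(`norm_sum_log_mul_commutator_le`).
-/

open scoped ComplexOrder
open Matrix Filter Topology

/-! ### Divided differences of the logarithm -/

/-- The divided difference of the logarithm, with its limiting value `a⁻¹` on the diagonal. -/
noncomputable def logSlope (a b : ℝ) : ℝ :=
  if a = b then a⁻¹ else (Real.log a - Real.log b) / (a - b)

lemma logSlope_comm (a b : ℝ) : logSlope a b = logSlope b a := by
  unfold logSlope
  by_cases h : a = b
  · simp [h]
  · rw [if_neg h, if_neg (Ne.symm h), ← neg_sub b a, ← neg_sub (Real.log b), neg_div_neg_eq]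

lemma logSlope_self (a : ℝ) : logSlope a a = a⁻¹ := if_pos rfl

lemma sub_mul_logSlope (a b : ℝ) : (a - b) * logSlope a b = Real.log a - Real.log b := by
  unfold logSlope
  by_cases h : a = b
  · simp [h]
  · rw [if_neg h, mul_div_cancel₀ _ (sub_ne_zero.2 h)]

lemma hasDerivAt_logSlope_add {a b s : ℝ} (ha : 0 < a + s) (hb : 0 < b + s) :
    HasDerivAt (fun s => logSlope (a + s) (b + s)) (-((a + s)⁻¹ * (b + s)⁻¹)) s := by
  have ha' : HasDerivAt (fun s => a + s) 1 s := (hasDerivAt_id s).const_add a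
  have hb' : HasDerivAt (fun s => b + s) 1 s := (hasDerivAt_id s).const_add b
  by_cases h : a = b
  · subst h
    simp only [logSlope_self]
    refine (ha'.fun_inv ha.ne').congr_deriv ?_
    field_simp
  · have h1 : ∀ s : ℝ, logSlope (a + s) (b + s) =
        (Real.log (a + s) - Real.log (b + s)) / (a - b) := fun s => by
      rw [logSlope, if_neg (by simpa using h)]; congr 1; ring
    simp only [h1]
    refine (((ha'.log ha.ne').sub (hb'.log hb.ne')).div_const (a - b)).congr_deriv ?_
    have := sub_ne_zero.2 h
    field_simp
    ring

lemma tendsto_logSlope_add (a b : ℝ) :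
    Tendsto (fun s => logSlope (a + s) (b + s)) atTop (𝓝 0) := by
  have hinv : ∀ a : ℝ, Tendsto (fun s => (a + s)⁻¹) atTop (𝓝 0) := fun a =>
    tendsto_inv_atTop_zero.comp (tendsto_atTop_add_const_left _ a tendsto_id)
  by_cases h : a = b
  · subst h
    simpa only [logSlope_self] using hinv a
  · have h1 : ∀ s : ℝ, logSlope (a + s) (b + s) =
        (Real.log (a + s) - Real.log (b + s)) / (a - b) := fun s => by
      rw [logSlope, if_neg (by simpa using h)]; congr 1; ring
    simp only [h1]
    have h2 : Tendsto (fun s => Real.log (1 + (a - b) * (b + s)⁻¹)) atTop (𝓝 0) := by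
      have : Tendsto (fun s => 1 + (a - b) * (b + s)⁻¹) atTop (𝓝 1) := by
        simpa using ((hinv b).const_mul (a - b)).const_add 1
      simpa [Function.comp_def] using (Real.continuousAt_log one_ne_zero).tendsto.comp this
    have h3 : Tendsto (fun s => Real.log (a + s) - Real.log (b + s)) atTop (𝓝 0) := by
      refine h2.congr' ?_
      filter_upwards [eventually_gt_atTop (-a), eventually_gt_atTop (-b)] with s h4 h5
      have h4 : 0 < a + s := by linarith
      have h5 : 0 < b + s := by linarith
      rw [← Real.log_div h4.ne' h5.ne']
      congr 1
      field_simp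
      ring
    simpa using h3.div_const (a - b)

section

variable {n : Type*} [Fintype n] [DecidableEq n]

/-- The Loewner matrix of the logarithm at positive points is positive semidefinite. Shifting all
the points by `s`, its quadratic form decreases in `s`, the derivative being minus the square of a
modulus, and it tends to `0` as `s → ∞`. -/
lemma posSemidef_logSlope {n : Type*} [Fintype n] {μ : n → ℝ} (hμ : ∀ i, 0 < μ i) :
    (Matrix.of fun i j => (logSlope (μ i) (μ j) : ℂ)).PosSemidef := by
  refine .of_dotProduct_mulVec_nonneg ?_ fun x => ?_
  · ext i j
    simp [logSlope_comm (μ j)]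
  set q : ℝ → ℂ := fun s => ∑ i, ∑ j, star (x i) * x j * (logSlope (μ i + s) (μ j + s) : ℂ) with hq
  have hq0 : star x ⬝ᵥ (Matrix.of fun i j => (logSlope (μ i) (μ j) : ℂ)) *ᵥ x = q 0 := by
    simp only [hq, dotProduct, mulVec, Finset.mul_sum, add_zero, Matrix.of_apply, Pi.star_apply]
    exact Finset.sum_congr rfl fun i _ => Finset.sum_congr rfl fun j _ => by ring
  have hder : ∀ s : ℝ, 0 ≤ s →
      HasDerivAt q (-((‖∑ i, x i * (((μ i + s)⁻¹ : ℝ) : ℂ)‖ ^ 2 : ℝ) : ℂ)) s := by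
    intro s hs
    have h1 : HasDerivAt q (∑ i, ∑ j, star (x i) * x j *
        ((-((μ i + s)⁻¹ * (μ j + s)⁻¹) : ℝ) : ℂ)) s :=
      HasDerivAt.fun_sum fun i _ => HasDerivAt.fun_sum fun j _ => HasDerivAt.const_mul _
        (hasDerivAt_logSlope_add (by linarith [hμ i]) (by linarith [hμ j])).ofReal_comp
    convert h1 using 1
    rw [Complex.ofReal_pow, ← Complex.conj_mul', map_sum, Finset.sum_mul_sum,
      ← Finset.sum_neg_distrib]
    refine Finset.sum_congr rfl fun i _ => ?_
    rw [← Finset.sum_neg_distrib]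
    refine Finset.sum_congr rfl fun j _ => ?_
    rw [map_mul, Complex.conj_ofReal]
    push_cast
    simp only [RCLike.star_def]
    ring
  have hlim : Tendsto q atTop (𝓝 0) := by
    have : Tendsto q atTop (𝓝 (∑ i : n, ∑ j : n, star (x i) * x j * ((0 : ℝ) : ℂ))) :=
      tendsto_finsetSum _ fun i _ => tendsto_finsetSum _ fun j _ => Tendsto.const_mul _
        ((Complex.continuous_ofReal.tendsto 0).comp (tendsto_logSlope_add (μ i) (μ j)))
    simpa using this
  have hre : ∀ s : ℝ, 0 ≤ s →
      HasDerivAt (fun s => (q s).re) (-(‖∑ i, x i * (((μ i + s)⁻¹ : ℝ) : ℂ)‖ ^ 2)) s := by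
    intro s hs
    have := Complex.reCLM.hasFDerivAt.comp_hasDerivAt s (hder s hs)
    simpa only [Function.comp_def, Complex.reCLM_apply, Complex.neg_re, Complex.ofReal_re] using this
  have hanti : AntitoneOn (fun s => (q s).re) (Set.Ici 0) := by
    refine antitoneOn_of_deriv_nonpos (convex_Ici 0)
      (fun s hs => (hre s hs).continuousAt.continuousWithinAt)
      (fun s hs => (hre s (interior_subset hs)).differentiableAt.differentiableWithinAt)
      fun s hs => ?_
    rw [(hre s (interior_subset hs)).deriv]
    exact neg_nonpos.2 (sq_nonneg _)
  have hge : 0 ≤ (q 0).re := by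
    refine le_of_tendsto' (f := fun s : ℝ => (q |s|).re) (x := atTop) ?_ fun s =>
      hanti Set.self_mem_Ici (abs_nonneg s) (abs_nonneg s)
    have h1 := (Complex.continuous_re.tendsto 0).comp (hlim.comp tendsto_abs_atTop_atTop)
    simpa [Function.comp_def] using h1
  have him : (q 0).im = 0 := by
    rw [← Complex.conj_eq_iff_im]
    simp only [hq, map_sum, map_mul, Complex.conj_ofReal, RCLike.star_def, Complex.conj_conj]
    rw [Finset.sum_comm]
    exact Finset.sum_congr rfl fun i _ => Finset.sum_congr rfl fun j _ => by
      rw [logSlope_comm]; ring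
  rw [hq0, Complex.le_def]
  exact ⟨by simpa using hge, by simp [him]⟩

/-! ### The commutator bound -/

/-- A matrix `X` with `0 ≤ X ≤ 1` is within `1/2` of half the identity, column by column. -/
lemma sum_norm_sq_sub_half_le {X : Matrix n n ℂ} (h0 : X.PosSemidef) (h1 : (1 - X).PosSemidef)
    (i : n) : ∑ j, ‖(X - (1 / 2 : ℂ) • (1 : Matrix n n ℂ)) j i‖ ^ 2 ≤ 1 / 4 := by
  have hX : Xᴴ = X := h0.isHermitian
  have hP : (X - X * X).PosSemidef := by
    have h2 := (h1.conjTranspose_mul_mul_same X).add (h0.conjTranspose_mul_mul_same (1 - X))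
    rw [conjTranspose_sub, conjTranspose_one, hX] at h2
    convert h2 using 1
    noncomm_ring
  set Y := X - (1 / 2 : ℂ) • (1 : Matrix n n ℂ) with hY
  have hYY : Yᴴ * Y = (1 / 4 : ℂ) • (1 : Matrix n n ℂ) - (X - X * X) := by
    have : Yᴴ = Y := by simp [hY, conjTranspose_sub, conjTranspose_smul, hX]
    rw [this, hY]
    simp only [sub_mul, mul_sub, smul_mul_assoc, mul_smul_comm, one_mul, mul_one]
    module
  have h3 : ((∑ j, ‖Y j i‖ ^ 2 : ℝ) : ℂ) = (Yᴴ * Y) i i := by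
    rw [mul_apply]
    push_cast
    exact Finset.sum_congr rfl fun j _ => by
      rw [conjTranspose_apply, RCLike.star_def, Complex.conj_mul']
  have h4 := (Complex.le_def.1 (hP.diag_nonneg (i := i))).1
  have h5 := congrArg Complex.re (h3.trans (congrArg (fun M : Matrix n n ℂ => M i i) hYY))
  rw [Complex.ofReal_re] at h5
  rw [h5]
  simp at h4 ⊢
  linarith

lemma norm_sum_mul_le {n : Type*} [Fintype n] {u v : n → ℂ} {a b : ℝ} (ha : 0 ≤ a) (hb : 0 ≤ b)
    (hu : ∑ j, ‖u j‖ ^ 2 ≤ a ^ 2) (hv : ∑ j, ‖v j‖ ^ 2 ≤ b ^ 2) :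
    ‖∑ j, u j * v j‖ ≤ a * b := by
  refine abs_le_of_sq_le_sq' ?_ (mul_nonneg ha hb) |>.2
  calc ‖∑ j, u j * v j‖ ^ 2 ≤ (∑ j, ‖u j‖ * ‖v j‖) ^ 2 := by
        gcongr
        exact (norm_sum_le _ _).trans_eq (by simp)
    _ ≤ (∑ j, ‖u j‖ ^ 2) * ∑ j, ‖v j‖ ^ 2 := Finset.sum_mul_sq_le_sq_mul_sq _ _ _
    _ ≤ a ^ 2 * b ^ 2 := by gcongr
    _ = (a * b) ^ 2 := by ring

/-- If `A` and `B` are positive semidefinite and `A + B` is diagonal, then `A` vanishes on the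
rows where `A + B` does. -/
lemma apply_eq_zero_of_add_eq_diagonal {A B : Matrix n n ℂ} (hA : A.PosSemidef)
    (hB : B.PosSemidef) {l : n → ℝ} (hAB : A + B = diagonal fun i => (l i : ℂ)) {i : n}
    (hi : l i = 0) (j : n) : A j i = 0 := by
  have hs : A i i + B i i = 0 := by
    rw [← Matrix.add_apply, hAB, diagonal_apply_eq, hi, Complex.ofReal_zero]
  have hAi : A i i = 0 :=
    le_antisymm ((le_add_of_nonneg_right hB.diag_nonneg).trans_eq hs) hA.diag_nonneg
  have h1 := (hA.dotProduct_mulVec_zero_iff (Pi.single i 1)).1 (by simp [hAi])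
  simpa using congrFun h1 j

/-- The bound on the mixing rate in an eigenbasis of `ρ = A + B = diag l`. The matrix `X`, the
derivative of the logarithm at `ρ` in the direction `A`, satisfies `[log ρ, A] = [ρ, X]` and
`0 ≤ X ≤ 1`, so that `X` may be replaced by `X - 1/2`, whose columns have norm at most `1/2`. -/
lemma norm_sum_log_mul_commutator_le {A B H : Matrix n n ℂ} (hA : A.PosSemidef)
    (hB : B.PosSemidef) {l : n → ℝ} (hl : ∀ i, 0 ≤ l i) (hsum : ∑ i, l i = 1)
    (hAB : A + B = diagonal fun i => (l i : ℂ)) (hH : H.IsHermitian) {h : ℝ} (hh : 0 ≤ h)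
    (hcol : ∀ i, ∑ j, ‖H j i‖ ^ 2 ≤ h ^ 2) :
    ‖∑ i, (Real.log (l i) : ℂ) * (H * A - A * H) i i‖ ≤ h := by
  -- the value `1` at zero eigenvalues is immaterial, as `A` and `B` vanish there
  set μ : n → ℝ := fun i => if l i = 0 then 1 else l i with hμdef
  have hμ : ∀ i, 0 < μ i := fun i => by
    simp only [hμdef]; split_ifs with h0
    · exact one_pos
    · exact (hl i).lt_of_ne' h0
  set K := Matrix.of fun i j => (logSlope (μ i) (μ j) : ℂ) with hK
  have hKpos : K.PosSemidef := posSemidef_logSlope hμ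
  set X := K ⊙ A with hX
  have hX0 : X.PosSemidef := hKpos.hadamard hA
  have hX1 : (1 - X).PosSemidef := by
    have h1 : (1 : Matrix n n ℂ) - X = K ⊙ B + diagonal fun i => if l i = 0 then (1 : ℂ) else 0 := by
      rw [sub_eq_iff_eq_add, add_assoc, add_comm (diagonal _), ← add_assoc, add_comm (K ⊙ B),
        hX, ← hadamard_add, hAB]
      ext i j
      by_cases hij : i = j
      · subst hij
        by_cases h0 : l i = 0
        · simp [h0]
        · simp [h0, hK, hμdef, logSlope_self]
      · simp [hij]
    rw [h1]
    refine (hKpos.hadamard hB).add (.diagonal fun i => ?_)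
    dsimp only
    split_ifs <;> simp
  set Y := X - (1 / 2 : ℂ) • (1 : Matrix n n ℂ) with hY
  have hcomm : ∀ i j, ((Real.log (l i) : ℂ) - Real.log (l j)) * A j i = ((l i : ℂ) - l j) * Y j i := by
    intro i j
    have hYX : ((l i : ℂ) - l j) * Y j i = ((l i : ℂ) - l j) * X j i := by
      by_cases hij : j = i
      · simp [hij]
      · simp [hY, hij]
    rw [hYX]
    by_cases hi : l i = 0
    · simp [hX, apply_eq_zero_of_add_eq_diagonal hA hB hAB hi j]
    by_cases hj : l j = 0
    · have : A j i = 0 := by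
        rw [← hA.isHermitian.apply, apply_eq_zero_of_add_eq_diagonal hA hB hAB hj i, star_zero]
      simp [hX, this]
    have h2 := sub_mul_logSlope (l i) (l j)
    simp only [hX, hK, hμdef, hadamard_apply, of_apply, hi, hj, if_false]
    rw [logSlope_comm, ← mul_assoc, ← Complex.ofReal_sub, ← Complex.ofReal_sub, ← h2,
      Complex.ofReal_mul]
  have hswap : ∀ (a : n → ℂ) (Z : Matrix n n ℂ), ∑ i, a i * (H * Z - Z * H) i i =
      ∑ i, ∑ j, H i j * ((a i - a j) * Z j i) := by
    intro a Z
    have h3 : ∑ i, a i * (Z * H) i i = ∑ i, ∑ j, H i j * (a j * Z j i) := by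
      rw [Finset.sum_comm]
      refine Finset.sum_congr rfl fun i _ => ?_
      rw [mul_apply, Finset.mul_sum]
      exact Finset.sum_congr rfl fun j _ => by ring
    simp only [Matrix.sub_apply, mul_sub, Finset.sum_sub_distrib, sub_mul, h3]
    congr 1
    refine Finset.sum_congr rfl fun i _ => ?_
    rw [mul_apply, Finset.mul_sum]
    exact Finset.sum_congr rfl fun j _ => by ring
  have hmain : ∑ i, (Real.log (l i) : ℂ) * (H * A - A * H) i i =
      ∑ i, (l i : ℂ) * (H * Y - Y * H) i i := by
    rw [hswap, hswap]
    simp only [hcomm]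
  have hYH : ∀ i j, ‖Y i j‖ = ‖Y j i‖ := fun i j => by
    have : Y.IsHermitian := by
      have hXh : Xᴴ = X := hX0.isHermitian
      simp [IsHermitian, hY, conjTranspose_sub, conjTranspose_smul, hXh]
    rw [← this.apply, norm_star]
  have hHH : ∀ i j, ‖H i j‖ = ‖H j i‖ := fun i j => by rw [← hH.apply, norm_star]
  have hYcol : ∀ i, ∑ j, ‖Y j i‖ ^ 2 ≤ (1 / 2) ^ 2 := fun i =>
    (sum_norm_sq_sub_half_le hX0 hX1 i).trans_eq (by norm_num)
  have hterm : ∀ i, ‖(H * Y - Y * H) i i‖ ≤ h := fun i => by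
    have h4 : ‖(H * Y) i i‖ ≤ h * (1 / 2) := by
      rw [mul_apply]
      exact norm_sum_mul_le hh (by norm_num) (by simpa only [hHH i] using hcol i) (hYcol i)
    have h5 : ‖(Y * H) i i‖ ≤ 1 / 2 * h := by
      rw [mul_apply]
      exact norm_sum_mul_le (by norm_num) hh (by simpa only [hYH i] using hYcol i) (hcol i)
    rw [Matrix.sub_apply]
    exact (norm_sub_le _ _).trans (by linarith)
  rw [hmain]
  calc ‖∑ i, (l i : ℂ) * (H * Y - Y * H) i i‖ ≤ ∑ i, l i * h := by
        refine norm_sum_le_of_le _ fun i _ => ?_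
        rw [norm_mul, Complex.norm_real, Real.norm_of_nonneg (hl i)]
        exact mul_le_mul_of_nonneg_left (hterm i) (hl i)
    _ = h := by rw [← Finset.sum_mul, hsum, one_mul]

/-! ### Squeezing derivatives and quadratic bounds for the functional calculus -/

/-- A function squeezed between two functions that agree at `x` and have the same derivative there
has that derivative as well. -/
lemma HasDerivAt.of_squeeze {f g k : ℝ → ℝ} {d x : ℝ} (hf : HasDerivAt f d x)
    (hk : HasDerivAt k d x) (hfg : ∀ y, f y ≤ g y) (hgk : ∀ y, g y ≤ k y)
    (hx : f x = k x) : HasDerivAt g d x := by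
  have h1 : g x = f x := le_antisymm ((hgk x).trans hx.ge) (hfg x)
  rw [hasDerivAt_iff_isLittleO] at hf hk ⊢
  refine Asymptotics.IsLittleO.of_bound fun c hc => ?_
  filter_upwards [(hf.norm_left.add hk.norm_left).bound hc] with y hy
  refine le_trans ?_ hy
  rw [Real.norm_of_nonneg (add_nonneg (norm_nonneg _) (norm_nonneg _)), h1]
  simp only [Real.norm_eq_abs]
  have h2 := hfg y
  have h3 := hgk y
  have h4 := neg_abs_le (f y - f x - (y - x) • d)
  have h5 := le_abs_self (k y - k x - (y - x) • d)
  have h6 := abs_nonneg (f y - f x - (y - x) • d)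
  have h7 := abs_nonneg (k y - k x - (y - x) • d)
  rw [abs_le]
  constructor <;> linarith

lemma isBigO_sum_norm_sq {n : Type*} [Fintype n] {v : n → ℝ → ℂ} {v' : n → ℂ}
    (hv : ∀ j, HasDerivAt (v j) (v' j) 0)
    (h0 : ∀ j, v j 0 = 0) :
    (fun t => ∑ j, ‖v j t‖ ^ 2) =O[𝓝 0] fun t : ℝ => t ^ 2 := by
  refine Asymptotics.IsBigO.fun_sum fun j _ => ?_
  have := (hv j).isBigO_sub
  simp only [h0, sub_zero] at this
  exact this.norm_left.pow 2

lemma hasDerivAt_zero_of_isBigO_sq {g : ℝ → ℝ} (h : g =O[𝓝 0] fun t : ℝ => t ^ 2) :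
    HasDerivAt g 0 0 := by
  have h1 : HasFDerivAt g (0 : ℝ →L[ℝ] ℝ) 0 := by
    refine Asymptotics.IsBigO.hasFDerivAt (n := 2) ?_ one_lt_two
    simpa using h
  simpa using h1.hasDerivAt

lemma hasDerivAt_mul_log_sq {g : ℝ → ℝ} (h : g =O[𝓝 0] fun t : ℝ => t ^ 2) :
    HasDerivAt (fun t => g t * Real.log (t ^ 2)) 0 0 := by
  rw [hasDerivAt_iff_isLittleO]
  simp only [ne_eq, OfNat.ofNat_ne_zero, not_false_eq_true, zero_pow, Real.log_zero, mul_zero,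
    sub_zero, smul_zero]
  refine (h.mul (Asymptotics.isBigO_refl (fun t : ℝ => Real.log (t ^ 2)) _)).trans_isLittleO ?_
  have h1 : (fun t : ℝ => 2 * (t * Real.log t)) =o[𝓝 0] fun _ => (1 : ℝ) := by
    rw [Asymptotics.isLittleO_one_iff]
    have := (Real.continuous_mul_log.tendsto 0).const_mul 2
    simpa using this
  refine ((Asymptotics.isBigO_refl (fun t : ℝ => t) (𝓝 0)).mul_isLittleO h1).congr
    (fun t => ?_) fun t => mul_one t
  rw [Real.log_pow]
  push_cast
  ring

open scoped MatrixOrder in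
/-- If `f` is bounded on the spectrum of `M` by a quadratic polynomial centred at `x`, the
diagonal entries of `f(M)` are bounded by those of the polynomial at `M`. -/
lemma cfc_apply_self_re_le {M : Matrix n n ℂ} (hM : M.IsHermitian) {f : ℝ → ℝ} {a b c x : ℝ}
    (hf : ∀ y ∈ spectrum ℝ M, f y ≤ a + b * (y - x) + c * (y - x) ^ 2) (i : n) :
    (cfc f M i i).re ≤ a + b * ((M i i).re - x) +
      c * ∑ j, ‖(M - (x : ℂ) • (1 : Matrix n n ℂ)) j i‖ ^ 2 := by
  have hsa : IsSelfAdjoint M := hM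
  have hcont : ∀ g : ℝ → ℝ, ContinuousOn g (spectrum ℝ M) := fun g =>
    Matrix.finite_real_spectrum.continuousOn g
  have h1 : cfc f M ≤ cfc (fun y => a + b * (y - x) + c * (y - x) ^ 2) M :=
    cfc_mono hf (hcont _) (hcont _)
  set N := M - (x : ℂ) • (1 : Matrix n n ℂ) with hN
  have hNs : cfc (fun y : ℝ => y - x) M = N := by
    rw [cfc_sub _ _ M (hcont _) (hcont _), cfc_id' ℝ M, cfc_const x M]
    simp [hN, Algebra.algebraMap_eq_smul_one]
  have h2 : cfc (fun y => a + b * (y - x) + c * (y - x) ^ 2) M =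
      (a : ℂ) • (1 : Matrix n n ℂ) + (b : ℂ) • N + (c : ℂ) • (N * N) := by
    rw [cfc_add (a := M) _ _ (hcont _) (hcont _), cfc_add (a := M) _ _ (hcont _) (hcont _),
      cfc_const a M, cfc_const_mul _ _ M (hcont _), cfc_const_mul _ _ M (hcont _),
      cfc_pow _ _ M (hf := hcont _), hNs, pow_two]
    simp [Algebra.algebraMap_eq_smul_one]
  have hNN : ((∑ j, ‖N j i‖ ^ 2 : ℝ) : ℂ) = (N * N) i i := by
    have hNH : N.IsHermitian := by
      simp [IsHermitian, hN, conjTranspose_sub, conjTranspose_smul, hM.eq]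
    rw [mul_apply]
    push_cast
    exact Finset.sum_congr rfl fun j _ => by
      rw [← hNH.apply i j, RCLike.star_def, Complex.conj_mul']
  rw [h2] at h1
  have h3 := (Complex.le_def.1 (Matrix.PosSemidef.diag_nonneg (Matrix.le_iff.1 h1) (i := i))).1
  simp only [Matrix.sub_apply, Matrix.add_apply, Matrix.smul_apply, ← hNN, smul_eq_mul,
    Complex.sub_re, Complex.add_re, Complex.re_ofReal_mul, Complex.ofReal_re, one_apply_eq,
    Complex.zero_re, mul_one] at h3
  have h4 : (N i i).re = (M i i).re - x := by simp [hN]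
  rw [h4] at h3
  linarith

lemma spectrum_subset_Icc_of_isDensityMatrix {M : Matrix n n ℂ} (hM : IsDensityMatrix M) :
    spectrum ℝ M ⊆ Set.Icc 0 1 := by
  have hH := hM.posSemidef.isHermitian
  rw [hH.spectrum_real_eq_range_eigenvalues]
  rintro _ ⟨i, rfl⟩
  refine ⟨hM.posSemidef.eigenvalues_nonneg i, ?_⟩
  have h1 : ∑ j, hH.eigenvalues j = 1 := by
    have := hH.trace_eq_sum_eigenvalues
    rw [hM.trace_eq_one] at this
    exact (Complex.ofReal_injective (by simpa using this)).symm
  rw [← h1]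
  exact Finset.single_le_sum (f := hH.eigenvalues)
    (fun j _ => hM.posSemidef.eigenvalues_nonneg j) (Finset.mem_univ i)

lemma negMulLog_le_tangent {x y : ℝ} (hx : 0 < x) (hy : 0 ≤ y) :
    Real.negMulLog y ≤ Real.negMulLog x + (-Real.log x - 1) * (y - x) := by
  rcases hy.eq_or_lt with rfl | hy
  · simp [Real.negMulLog]; nlinarith
  have h1 := Real.one_sub_inv_le_log_of_pos (div_pos hy hx)
  rw [Real.log_div hy.ne' hx.ne', inv_div] at h1
  have h2 := mul_le_mul_of_nonneg_left h1 hy.le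
  have h3 : y * (1 - x / y) = y - x := by field_simp
  simp only [Real.negMulLog]
  linarith

/-- A quadratic minorant of `-y log y`, valid on the whole half-line, tangent at `x`. -/
lemma tangent_sub_sq_le_negMulLog {x y : ℝ} (hx : 0 < x) (hy : 0 ≤ y) :
    Real.negMulLog x + (-Real.log x - 1) * (y - x) - x⁻¹ * (y - x) ^ 2 ≤ Real.negMulLog y := by
  rcases hy.eq_or_lt with rfl | hy
  · simp [Real.negMulLog]; field_simp; linarith
  have h1 := Real.log_le_sub_one_of_pos (div_pos hy hx)
  rw [Real.log_div hy.ne' hx.ne'] at h1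
  have h2 := mul_le_mul_of_nonneg_left h1 hy.le
  have h3 : y * (y / x - 1) = (y - x) + x⁻¹ * (y - x) ^ 2 := by field_simp; ring
  simp only [Real.negMulLog]
  linarith

/-! ### Differentiability of the entropy along the evolution -/

lemma evolution_zero (H : Matrix n n ℂ) : evolution H 0 = 1 := by
  simp [evolution]

lemma evolution_neg_mul (H : Matrix n n ℂ) (t : ℝ) : evolution H (-t) * evolution H t = 1 := by
  rw [evolution, evolution, ← Matrix.exp_add_of_commute]
  · rw [← add_smul]; simp
  · exact ((Commute.refl H).smul_left _).smul_right _

lemma evolution_neg {H : Matrix n n ℂ} (hH : H.IsHermitian) (t : ℝ) :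
    evolution H (-t) = (evolution H t)ᴴ := by
  rw [evolution, evolution, ← Matrix.exp_conjTranspose, conjTranspose_smul, hH.eq]
  simp

open scoped Matrix.Norms.Operator in
lemma hasDerivAt_evolution (H : Matrix n n ℂ) : HasDerivAt (evolution H) (Complex.I • H) 0 := by
  have := hasDerivAt_exp_smul_const (𝕂 := ℝ) (Complex.I • H) 0
  rw [zero_smul, NormedSpace.exp_zero, one_mul] at this
  refine this.congr_of_eventuallyEq (.of_forall fun t => ?_)
  simp only [evolution]
  congr 1
  ext
  simp
  ring

open scoped Matrix.Norms.Operator in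
lemma hasDerivAt_evolution_neg (H : Matrix n n ℂ) :
    HasDerivAt (fun t : ℝ => evolution H (-t)) (-(Complex.I • H)) 0 := by
  have h1 : HasDerivAt (evolution H) (Complex.I • H) (-0) := by
    rw [neg_zero]; exact hasDerivAt_evolution H
  exact (h1.scomp (0 : ℝ) (hasDerivAt_neg 0)).congr_deriv (neg_one_smul ℝ _)

open scoped Matrix.Norms.Operator in
lemma hasDerivAt_matrix_apply {n : Type*} [Fintype n] {M : ℝ → Matrix n n ℂ} {M' : Matrix n n ℂ}
    {t : ℝ} (h : HasDerivAt M M' t) (i j : n) : HasDerivAt (fun t => M t i j) (M' i j) t :=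
  ((Matrix.entryLinearMap ℝ ℂ i j).toContinuousLinearMap.hasFDerivAt).comp_hasDerivAt t h

open scoped Matrix.Norms.Operator in
lemma hasDerivAt_conj_evolution_apply (A B H : Matrix n n ℂ) (i j : n) :
    HasDerivAt (fun t : ℝ => (B + evolution H t * A * evolution H (-t)) i j)
      (Complex.I * (H * A - A * H) i j) 0 := by
  have h1 := (((hasDerivAt_evolution H).mul_const A).mul (hasDerivAt_evolution_neg H)).const_add B
  refine (hasDerivAt_matrix_apply h1 i j).congr_deriv ?_
  simp [evolution_zero, mul_add, sub_eq_add_neg]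

lemma isDensityMatrix_conj_evolution {A B H : Matrix n n ℂ} (hA : A.PosSemidef)
    (hB : B.PosSemidef) (htr : (A + B).trace = 1) (hH : H.IsHermitian) (t : ℝ) :
    IsDensityMatrix (B + evolution H t * A * evolution H (-t)) where
  posSemidef := by
    rw [evolution_neg hH]
    exact hB.add (hA.mul_mul_conjTranspose_same _)
  trace_eq_one := by
    rw [trace_add, trace_mul_cycle, evolution_neg_mul, one_mul, ← trace_add, add_comm, htr]

open scoped MatrixOrder in
lemma Matrix.PosSemidef.exists_eq_conjTranspose_mul_self {A : Matrix n n ℂ}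
    (hA : A.PosSemidef) : ∃ R, A = Rᴴ * R :=
  CStarAlgebra.nonneg_iff_eq_star_mul_self.1 hA.nonneg

open scoped Matrix.Norms.Operator in
/-- On the kernel of `A` the diagonal entry of the evolved `A` is of second order in time, being
the squared norm of `R U(-t) e` where `A = R* R`. -/
lemma isBigO_conj_evolution_apply_self {A H : Matrix n n ℂ} (hA : A.PosSemidef)
    (hH : H.IsHermitian) {i : n} (hi : ∀ j, A j i = 0) :
    (fun t : ℝ => ((evolution H t * A * evolution H (-t)) i i).re) =O[𝓝 0]
      fun t : ℝ => t ^ 2 := by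
  obtain ⟨R, rfl⟩ : ∃ R, A = Rᴴ * R := hA.exists_eq_conjTranspose_mul_self
  have hR : ∀ j, R j i = 0 := fun j => by
    have h1 : ((∑ j, ‖R j i‖ ^ 2 : ℝ) : ℂ) = 0 := by
      rw [← hi i, mul_apply]
      push_cast
      exact Finset.sum_congr rfl fun j _ => by
        rw [conjTranspose_apply, RCLike.star_def, Complex.conj_mul']
    rw [Complex.ofReal_eq_zero, Finset.sum_eq_zero_iff_of_nonneg fun _ _ => sq_nonneg _] at h1
    simpa using h1 j (Finset.mem_univ j)
  have hd := fun j => hasDerivAt_matrix_apply ((hasDerivAt_evolution_neg H).const_mul R) j i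
  refine (isBigO_sum_norm_sq hd fun j => ?_).congr_left fun t => ?_
  · simp [evolution_zero, hR]
  · have h2 : evolution H t * (Rᴴ * R) * evolution H (-t) =
        (R * evolution H (-t))ᴴ * (R * evolution H (-t)) := by
      rw [conjTranspose_mul, evolution_neg hH, conjTranspose_conjTranspose]
      simp only [mul_assoc]
    rw [h2, mul_apply, ← Complex.ofReal_re (∑ j, _)]
    push_cast
    congr 1
    exact Finset.sum_congr rfl fun j _ => by
      rw [conjTranspose_apply, RCLike.star_def, Complex.conj_mul']


/-- The von Neumann entropy in nats is differentiable along `B + U(t) A U(-t)`, even where the rank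
drops, in the coordinates where `A + B = diag l`. Each diagonal entry of the entropy operator is
squeezed between two differentiable functions of the entries of the state. For an entry at
`l i > 0` these come from the tangent and a quadratic minorant of `-y log y` at `l i`; for `l i = 0`
from `0` and the tangent at `t ^ 2`, the entry of the state being `O(t ^ 2)`. -/
lemma hasDerivAt_trace_cfc_negMulLog {A B H : Matrix n n ℂ} (hA : A.PosSemidef)
    (hB : B.PosSemidef) {l : n → ℝ} (hl : ∀ i, 0 ≤ l i) (hsum : ∑ i, l i = 1)
    (hAB : A + B = diagonal fun i => (l i : ℂ)) (hH : H.IsHermitian) :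
    HasDerivAt
      (fun t : ℝ => (cfc Real.negMulLog (B + evolution H t * A * evolution H (-t))).trace.re)
      (-(∑ i, (Real.log (l i) : ℂ) * (Complex.I * (H * A - A * H) i i)).re) 0 := by
  set M : ℝ → Matrix n n ℂ := fun t => B + evolution H t * A * evolution H (-t) with hM
  have hdens : ∀ t, IsDensityMatrix (M t) := fun t =>
    isDensityMatrix_conj_evolution hA hB
      (by rw [hAB, trace_diagonal, ← Complex.ofReal_sum, hsum, Complex.ofReal_one]) hH t
  have hM0 : M 0 = diagonal fun i => (l i : ℂ) := by
    simp [hM, evolution_zero, ← hAB, add_comm]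
  have hMder : ∀ i j, HasDerivAt (fun t => M t i j) (Complex.I * (H * A - A * H) i j) 0 :=
    hasDerivAt_conj_evolution_apply A B H
  have hMre : ∀ i, HasDerivAt (fun t => (M t i i).re) (Complex.I * (H * A - A * H) i i).re 0 :=
    fun i => Complex.reCLM.hasFDerivAt.comp_hasDerivAt (0 : ℝ) (hMder i i)
  have hspec : ∀ t, ∀ y ∈ spectrum ℝ (M t), 0 ≤ y ∧ y ≤ 1 := fun t y hy =>
    spectrum_subset_Icc_of_isDensityMatrix (hdens t) hy
  have hupper : ∀ t i x, 0 < x → (cfc Real.negMulLog (M t) i i).re ≤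
      Real.negMulLog x + (-Real.log x - 1) * ((M t i i).re - x) := by
    intro t i x hx
    refine (cfc_apply_self_re_le (hdens t).posSemidef.isHermitian (a := Real.negMulLog x)
      (b := -Real.log x - 1) (c := 0) (x := x) (fun y hy => ?_) i).trans_eq (by ring)
    linarith [negMulLog_le_tangent hx (hspec t y hy).1]
  have hlower : ∀ t i (a b c x : ℝ), (∀ y, 0 ≤ y → y ≤ 1 →
      a + b * (y - x) + c * (y - x) ^ 2 ≤ Real.negMulLog y) →
      a + b * ((M t i i).re - x) + c * ∑ j, ‖(M t - (x : ℂ) • (1 : Matrix n n ℂ)) j i‖ ^ 2 ≤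
        (cfc Real.negMulLog (M t) i i).re := by
    intro t i a b c x hf
    have := cfc_apply_self_re_le (hdens t).posSemidef.isHermitian
      (f := fun y => -Real.negMulLog y) (a := -a) (b := -b) (c := -c) (x := x)
      (fun y hy => by linarith [hf y (hspec t y hy).1 (hspec t y hy).2]) i
    rw [cfc_neg, Matrix.neg_apply, Complex.neg_re] at this
    linarith
  have hentry : ∀ i, HasDerivAt (fun t => (cfc Real.negMulLog (M t) i i).re)
      ((if l i = 0 then 0 else -Real.log (l i) - 1) * (Complex.I * (H * A - A * H) i i).re) 0 := by
    intro i
    by_cases hi : l i = 0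
    · have hA0 := apply_eq_zero_of_add_eq_diagonal hA hB hAB hi
      have hB0 := apply_eq_zero_of_add_eq_diagonal hB hA ((add_comm B A).trans hAB) hi
      have hbig : (fun t => (M t i i).re) =O[𝓝 0] fun t : ℝ => t ^ 2 := by
        simpa [hM, hB0] using isBigO_conj_evolution_apply_self hA hH hA0
      have hM00 : (M 0 i i).re = 0 := by simp [hM0, hi]
      rw [if_pos hi, zero_mul]
      refine (hasDerivAt_const (0 : ℝ) (0 : ℝ)).of_squeeze
        (k := fun t => t ^ 2 - (M t i i).re - (M t i i).re * Real.log (t ^ 2)) ?_ ?_ ?_ ?_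
      · have h1 := ((hasDerivAt_pow 2 (0 : ℝ)).sub (hasDerivAt_zero_of_isBigO_sq hbig)).sub
          (hasDerivAt_mul_log_sq hbig)
        refine h1.congr_deriv (by simp)
      · intro t
        simpa using hlower t i 0 0 0 0 fun y h0 h1 => by
          simpa using Real.negMulLog_nonneg h0 h1
      · intro t
        by_cases ht : t = 0
        · subst ht
          simp only [hM00, ne_eq, OfNat.ofNat_ne_zero, not_false_eq_true, zero_pow, zero_mul,
            sub_zero]
          refine le_of_forall_pos_le_add fun x hx => (hupper 0 i x hx).trans_eq ?_
          rw [hM00, Real.negMulLog]; ring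
        · refine (hupper t i (t ^ 2) (by positivity)).trans_eq ?_
          rw [Real.negMulLog]; ring
      · simp [hM00]
    · have hpos := (hl i).lt_of_ne' hi
      have hM00 : (M 0 i i).re = l i := by simp [hM0]
      rw [if_neg hi]
      have htan : HasDerivAt (fun t => Real.negMulLog (l i) + (-Real.log (l i) - 1) *
          ((M t i i).re - l i)) ((-Real.log (l i) - 1) * (Complex.I * (H * A - A * H) i i).re) 0 :=
        (((hMre i).sub_const (l i)).const_mul _).const_add _
      have hz : ∀ j, (M 0 - (l i : ℂ) • (1 : Matrix n n ℂ)) j i = 0 := fun j => by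
        by_cases hj : j = i <;> simp [hM0, hj]
      have hquad := (hasDerivAt_zero_of_isBigO_sq (isBigO_sum_norm_sq
        (v := fun j t => (M t - (l i : ℂ) • (1 : Matrix n n ℂ)) j i)
        (fun j => (hMder j i).sub_const _) hz)).const_mul (-(l i)⁻¹)
      refine ((htan.add hquad).congr_deriv (by ring)).of_squeeze htan (fun t => ?_)
        (fun t => hupper t i _ hpos) ?_
      · refine hlower t i _ _ _ _ fun y h0 _ => ?_
        linarith [tangent_sub_sq_le_negMulLog hpos h0]
      · change _ + -(l i)⁻¹ * ∑ j, ‖(M 0 - (l i : ℂ) • (1 : Matrix n n ℂ)) j i‖ ^ 2 = _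
        rw [Finset.sum_eq_zero fun j _ => by rw [hz, norm_zero, zero_pow two_ne_zero], mul_zero,
          add_zero]
  have htrace : HasDerivAt (fun t => (cfc Real.negMulLog (M t)).trace.re) (∑ i,
      (if l i = 0 then 0 else -Real.log (l i) - 1) * (Complex.I * (H * A - A * H) i i).re) 0 := by
    simp only [trace, diag_apply, Complex.re_sum]
    exact HasDerivAt.fun_sum fun i _ => hentry i
  refine htrace.congr_deriv ?_
  -- the contributions of the constant `-1` add up to the trace of a commutator
  have hcomm : ∑ i, (Complex.I * (H * A - A * H) i i).re = 0 := by
    rw [← Complex.re_sum, ← Finset.mul_sum]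
    change (Complex.I * (H * A - A * H).trace).re = 0
    rw [trace_sub, trace_mul_comm, sub_self, mul_zero, Complex.zero_re]
  have hzero : ∀ i, l i = 0 → (H * A - A * H) i i = 0 := fun i hi => by
    have hA0 := apply_eq_zero_of_add_eq_diagonal hA hB hAB hi
    have hA0' : ∀ j, A i j = 0 := fun j => by rw [← hA.isHermitian.apply, hA0, star_zero]
    simp [mul_apply, hA0, hA0']
  refine Eq.trans ?_ (sub_zero _)
  conv_rhs => rw [← hcomm]
  rw [Complex.re_sum, ← Finset.sum_neg_distrib, ← Finset.sum_sub_distrib]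
  refine Finset.sum_congr rfl fun i _ => ?_
  by_cases hi : l i = 0
  · simp [hi, hzero i hi]
  · rw [if_neg hi, Complex.re_ofReal_mul]
    ring

/-! ### Passage to an eigenbasis -/

lemma vonNeumannEntropy_eq_trace_cfc_negMulLog {M : Matrix n n ℂ} (hM : M.IsHermitian) :
    vonNeumannEntropy M = (cfc Real.negMulLog M).trace.re / Real.log 2 := by
  have hsa : IsSelfAdjoint M := hM
  have hcont : ∀ g : ℝ → ℝ, ContinuousOn g (spectrum ℝ M) := fun g =>
    Matrix.finite_real_spectrum.continuousOn g
  have h1 : M * cfc (Real.logb 2) M = cfc (fun x => -(Real.log 2)⁻¹ * Real.negMulLog x) M := by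
    conv_lhs => enter [1]; rw [← cfc_id' ℝ M]
    rw [← cfc_mul _ _ M (hcont _) (hcont _)]
    refine cfc_congr fun x _ => ?_
    simp only [Real.logb, Real.negMulLog]
    ring
  rw [vonNeumannEntropy, h1, cfc_const_mul _ _ M (hcont _), trace_smul, Complex.smul_re]
  simp only [smul_eq_mul]
  ring

lemma trace_cfc_unitary_conj {M : Matrix n n ℂ} (hM : M.IsHermitian) (V : unitary (Matrix n n ℂ))
    (f : ℝ → ℝ) : (cfc f ((V : Matrix n n ℂ) * M * star (V : Matrix n n ℂ))).trace =
      (cfc f M).trace := by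
  have hsa : IsSelfAdjoint M := hM
  have hsa' : IsSelfAdjoint (Unitary.conjStarAlgAut ℂ (Matrix n n ℂ) V M) := hsa.map _
  have h1 := StarAlgHomClass.map_cfc (S := ℂ) (Unitary.conjStarAlgAut ℂ (Matrix n n ℂ) V) f M
    (Matrix.finite_real_spectrum.continuousOn f)
    (by
      change Continuous fun x : Matrix n n ℂ => (V : Matrix n n ℂ) * x * star (V : Matrix n n ℂ)
      fun_prop) hsa hsa'
  rw [Unitary.conjStarAlgAut_apply, Unitary.conjStarAlgAut_apply] at h1
  rw [← h1, trace_mul_cycle, Unitary.coe_star_mul_self, one_mul]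

lemma evolution_unitary_conj (H : Matrix n n ℂ) (V : unitary (Matrix n n ℂ)) (t : ℝ) :
    evolution (star (V : Matrix n n ℂ) * H * (V : Matrix n n ℂ)) t =
      star (V : Matrix n n ℂ) * evolution H t * (V : Matrix n n ℂ) := by
  have hinv : (V : Matrix n n ℂ)⁻¹ = star (V : Matrix n n ℂ) :=
    Matrix.inv_eq_left_inv (Unitary.coe_star_mul_self V)
  have hu : IsUnit (V : Matrix n n ℂ) := (Unitary.toUnits V).isUnit
  rw [evolution, evolution, ← hinv, ← Matrix.exp_conj' _ _ hu]
  simp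

open scoped Matrix.Norms.L2Operator in
lemma operatorNorm_unitary_conj (H : Matrix n n ℂ) (V : unitary (Matrix n n ℂ)) :
    operatorNorm (star (V : Matrix n n ℂ) * H * (V : Matrix n n ℂ)) = operatorNorm H := by
  simp only [operatorNorm, Matrix.l2_opNorm_toEuclideanCLM]
  rw [CStarRing.norm_mul_coe_unitary, ← Unitary.coe_star, CStarRing.norm_coe_unitary_mul]

lemma operatorNorm_nonneg (H : Matrix n n ℂ) : 0 ≤ operatorNorm H := norm_nonneg _

lemma sum_norm_sq_col_le_operatorNorm_sq (H : Matrix n n ℂ) (i : n) :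
    ∑ j, ‖H j i‖ ^ 2 ≤ operatorNorm H ^ 2 := by
  have h1 := (Matrix.toEuclideanCLM (n := n) (𝕜 := ℂ) H).le_opNorm (PiLp.single 2 i 1)
  rw [PiLp.norm_single, norm_one, mul_one] at h1
  have h2 := pow_le_pow_left₀ (norm_nonneg _) h1 2
  rw [EuclideanSpace.norm_sq_eq] at h2
  simpa [Matrix.ofLp_toEuclideanCLM, operatorNorm] using h2

end

theorem mainTheorem4 {n : Type*} [Fintype n] [DecidableEq n]
    (E : TwoStateEnsemble n) (H : Matrix n n ℂ) (hH : H.IsHermitian) :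
    DifferentiableAt ℝ (E.entropyAt H) 0 ∧ mixingRate E H ≤ 2 * operatorNorm H := by
  have hp : ∀ α, (0 : ℂ) ≤ (E.p α : ℂ) := fun α => Complex.zero_le_real.2 (E.p_nonneg α)
  set A₀ := (E.p 1 : ℂ) • E.state 1 with hA₀
  set B₀ := (E.p 0 : ℂ) • E.state 0 with hB₀
  have hA₀pos : A₀.PosSemidef := (E.state_density 1).posSemidef.smul (hp 1)
  have hB₀pos : B₀.PosSemidef := (E.state_density 0).posSemidef.smul (hp 0)
  have hρ : (A₀ + B₀).PosSemidef := hA₀pos.add hB₀pos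
  have htr : (A₀ + B₀).trace = 1 := by
    rw [hA₀, hB₀, trace_add, trace_smul, trace_smul, (E.state_density 0).trace_eq_one,
      (E.state_density 1).trace_eq_one, smul_eq_mul, smul_eq_mul, mul_one, mul_one, add_comm,
      ← Complex.ofReal_add, E.p_sum, Complex.ofReal_one]
  set V := hρ.isHermitian.eigenvectorUnitary with hV
  set l := hρ.isHermitian.eigenvalues with hl
  have hVV : (V : Matrix n n ℂ) * star (V : Matrix n n ℂ) = 1 := Unitary.coe_mul_star_self V
  set A := star (V : Matrix n n ℂ) * A₀ * V with hA
  set B := star (V : Matrix n n ℂ) * B₀ * V with hB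
  set K := star (V : Matrix n n ℂ) * H * V with hK
  have hApos : A.PosSemidef := hA₀pos.conjTranspose_mul_mul_same _
  have hBpos : B.PosSemidef := hB₀pos.conjTranspose_mul_mul_same _
  have hKherm : K.IsHermitian := isHermitian_conjTranspose_mul_mul _ hH
  have hAB : A + B = diagonal fun i => (l i : ℂ) := by
    have := hρ.isHermitian.conjStarAlgAut_star_eigenvectorUnitary
    rw [Unitary.conjStarAlgAut_star_apply] at this
    rw [hA, hB, ← add_mul, ← mul_add]
    exact this
  have hsum : ∑ i, l i = 1 := by
    have := hρ.isHermitian.trace_eq_sum_eigenvalues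
    rw [htr] at this
    exact (Complex.ofReal_injective (by simpa using this)).symm
  have hevolved : ∀ t, E.evolved H t = (V : Matrix n n ℂ) *
      (B + evolution K t * A * evolution K (-t)) * star (V : Matrix n n ℂ) := by
    intro t
    have hcancel : ∀ Z : Matrix n n ℂ, (V : Matrix n n ℂ) * (star (V : Matrix n n ℂ) * Z) = Z :=
      fun Z => by rw [← mul_assoc, hVV, one_mul]
    rw [hK, evolution_unitary_conj H V, evolution_unitary_conj H V, TwoStateEnsemble.evolved, hA, hB]
    simp only [mul_add, add_mul, mul_assoc, hcancel, hVV, mul_one]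
    simp [hA₀, hB₀]
  have hdens : ∀ t, (B + evolution K t * A * evolution K (-t)).IsHermitian := fun t => by
    rw [evolution_neg hKherm]
    exact (hBpos.add (hApos.mul_mul_conjTranspose_same _)).isHermitian
  have hentropy : E.entropyAt H = fun t =>
      (cfc Real.negMulLog (B + evolution K t * A * evolution K (-t))).trace.re / Real.log 2 := by
    funext t
    have hher : (E.evolved H t).IsHermitian := by
      rw [hevolved]
      exact isHermitian_mul_mul_conjTranspose _ (hdens t)
    rw [TwoStateEnsemble.entropyAt, vonNeumannEntropy_eq_trace_cfc_negMulLog hher, hevolved,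
      trace_cfc_unitary_conj (hdens t)]
  have hderiv := (hasDerivAt_trace_cfc_negMulLog hApos hBpos (fun i => hρ.eigenvalues_nonneg i)
    hsum hAB hKherm).div_const (Real.log 2)
  rw [← hentropy] at hderiv
  refine ⟨hderiv.differentiableAt, ?_⟩
  rw [mixingRate, hderiv.deriv]
  have hbound := norm_sum_log_mul_commutator_le hApos hBpos (fun i => hρ.eigenvalues_nonneg i)
    hsum hAB hKherm (operatorNorm_nonneg K) (sum_norm_sq_col_le_operatorNorm_sq K)
  rw [hK, operatorNorm_unitary_conj] at hbound
  have hle : -(∑ i, (Real.log (l i) : ℂ) * (Complex.I * (K * A - A * K) i i)).re ≤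
      operatorNorm H := by
    have h1 : ∑ i, (Real.log (l i) : ℂ) * (Complex.I * (K * A - A * K) i i) =
        Complex.I * ∑ i, (Real.log (l i) : ℂ) * (K * A - A * K) i i := by
      rw [Finset.mul_sum]
      exact Finset.sum_congr rfl fun i _ => by ring
    rw [h1]
    refine (neg_le_abs _).trans ((Complex.abs_re_le_norm _).trans ?_)
    rw [norm_mul, Complex.norm_I, one_mul]
    exact hbound
  rw [div_le_iff₀ (Real.log_pos one_lt_two)]
  -- the bound in nats, `‖H‖`, is below `2 * log 2 * ‖H‖`
  have hlog : 1 / 2 ≤ Real.log 2 := by linarith [Real.log_two_gt_d9]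
  nlinarith [operatorNorm_nonneg H]
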